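/- **Theorem 4.4 (Joint convexity of relative entropy).** Let $\mathcal V$ be a Euclidean Jordan algebra, that is, a finite-dimensional real inner product space with a commutative bilinear product $\circ$ with unit $u$ satisfying $x^2\circ(x\circ y)=x\circ(x^2\circ y)$ and $\langle x\circ y,z\rangle=\langle x,y\circ z\rangle$. Put $\mathrm{tr}\,x:=\langle x,u\rangle$. A state is an element $\rho\in\{x\circ x\mid x\in\mathcal V\}$ with $\mathrm{tr}\,\rho=1$. Every $x\in\mathcal V$ has a unique spectral decomposition $x=\sum_j\lambda_jc_j$ with distinct real $\lambda_j$ and nonzero idempotents $c_j$ such that $c_j\circ c_l=0$ for $j\ne l$ and $\sum_jc_j=u$; put $\log x:=\sum_j(\log\lambda_j)c_j$. For states $\rho,\sigma$ the relative entropy is $$D(\rho\|\sigma):=\mathrm{tr}\bigl(\rho\circ\log\rho-\rho\circ\log\sigma\bigr)\in(-\infty,\infty],$$ where an eigenvalue $0$ contributes $0$ to $\log\rho$ and $\log\sigma$, and $D(\rho\|\sigma):=\infty$ if $\sigma$ has the eigenvalue $0$, with idempotent $c_0$, and $\mathrm{tr}(\rho\circ c_0)\neq0$ (that is, if the support of $\rho$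 is not contained in that of $\sigma$). Let $\rho_i,\sigma_i$ $(i=1,\dots,k)$ be states in $\mathcal V$ and let $\{p_i\}_{i=1}^k$ be a probability distribution. Then, with $0\cdot\infty:=0$, $$\sum_{i=1}^k p_i\,D(\rho_i\|\sigma_i)\;\ge\; D\Bigl(\sum_{i=1}^k p_i\rho_i\Big\|\sum_{i=1}^k p_i\sigma_i\Bigr).$$ -/

import Mathlib

/-- A (unital) Euclidean Jordan algebra: a finite-dimensional real inner product space `V` with a
commutative bilinear product `*` (the Jordan product) with unit `1`, satisfying the Jordan identity
(`IsCommJordan`), and such that `⟪x * y, z⟫ = ⟪x, y * z⟫`. The product need not be associative.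
No normalization of the inner product is imposed; the one giving every primitive idempotent the trace
`1` is a special case. -/
class EuclideanJordanAlgebra (V : Type*) extends NonAssocCommRing V, NormedAddCommGroup V,
    InnerProductSpace ℝ V, IsCommJordan V, IsScalarTower ℝ V V, FiniteDimensional ℝ V where
  inner_mul_assoc : ∀ x y z : V, Inner.inner ℝ (x * y) z = Inner.inner ℝ x (y * z)

namespace EuclideanJordanAlgebra

variable {V : Type*} [EuclideanJordanAlgebra V]

/-- The trace `tr x = ⟪x, 1⟫`. -/
noncomputable def tr (x : V) : ℝ := inner ℝ x 1

/-- The positive cone: the set of squares. -/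
def positiveCone (V : Type*) [EuclideanJordanAlgebra V] : Set V := {x | ∃ y : V, x = y * y}

/-- States: elements of the positive cone of trace one. -/
def IsState (ρ : V) : Prop := ρ ∈ positiveCone V ∧ tr ρ = 1

/-- `c` is a spectral decomposition of `x`: its support is a finite set of distinct reals (the
eigenvalues of `x`), the elements `c t` with `t` in the support are nonzero pairwise orthogonal
idempotents that sum to the unit, and `x = ∑ t • c t`. By the spectral theorem every `x` has
exactly one spectral decomposition. -/
structure IsSpectralDecomposition (x : V) (c : ℝ →₀ V) : Prop where
  idempotent : ∀ t, c t * c t = c t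
  orthogonal : ∀ s t, s ≠ t → c s * c t = 0
  complete : c.sum (fun _ e => e) = 1
  eq_sum : x = c.sum (fun t e => t • e)

open Classical in
/-- The spectral decomposition of `x`. -/
noncomputable def spectral (x : V) : ℝ →₀ V :=
  if h : ∃ c : ℝ →₀ V, IsSpectralDecomposition x c then h.choose else 0

/-- Functional calculus: `f(x) = ∑ f(t) • c_t`, where `x = ∑ t • c_t` is the spectral
decomposition. -/
noncomputable def funCalc (f : ℝ → ℝ) (x : V) : V := (spectral x).sum (fun t e => f t • e)

/-- The logarithm `log x = ∑ log t • c_t`. On the positive cone the eigenvalue `0`, if it occurs,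
contributes `0` (as `Real.log 0 = 0`), so that `x * log x` follows the convention
`0 log 0 = 0`. -/
noncomputable def log (x : V) : V := funCalc Real.log x

open Classical in
/-- The relative entropy `D(ρ‖σ) = tr (ρ ∘ log ρ - ρ ∘ log σ)`. For `σ` without the eigenvalue `0`
(so that `log σ` is defined in the strict sense) the condition below holds trivially, because
`spectral σ 0 = 0`. In general, `spectral σ 0` is the idempotent of the kernel of `σ`, and
`D(ρ‖σ) = ∞` unless the support of `ρ` is contained in that of `σ`, that is, unless `ρ` gives the
kernel of `σ` weight zero. -/
noncomputable def relEntropy (ρ σ : V) : EReal :=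
  if tr (ρ * spectral σ 0) = 0 then ((tr (ρ * log ρ - ρ * log σ) : ℝ) : EReal) else ⊤

end EuclideanJordanAlgebra

/-!
For positive definite `A`, `B`, a version of Frenkel's integral formula expresses
`⟪log (A + B) - log A, B⟫` as an integral over `c > 0`, with nonnegative density, of the trace of
the negative part of `A - c • B`. That trace is a subadditive function, hence so is
`⟪log (A + B) - log A, B⟫`. Replacing `A` by `ε • σ` and `B` by `ρ`, and letting `ε → 0`, gives
subadditivity of the relative entropy, which is homogeneous of degree one; the boundary of the cone
is reached by adding `ε • 1` to both arguments.

The integral formula rests on a Jordan-algebraic form of Sylvester's law of inertia: the flow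
`exp (s L(a))` of the multiplication operator of `a` preserves the traces of the spectral
projections onto the positive and the negative eigenvalues, and `exp (-L(log B))` maps `B` to `1`.
-/

open Filter Topology MeasureTheory Set

open scoped NNReal

namespace EuclideanJordanAlgebra

variable {V : Type*} [EuclideanJordanAlgebra V]

section SpectralTheorem

instance instSMulCommClassReal : SMulCommClass ℝ V V where
  smul_comm r x y := by
    simp only [smul_eq_mul]
    rw [mul_comm x (r • y), smul_mul_assoc, mul_comm x y]

lemma inner_mul_left (a x y : V) : inner ℝ (a * x) y = inner ℝ x (a * y) := by
  rw [mul_comm, inner_mul_assoc]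

lemma mulLeft_isSymmetric (x : V) : (LinearMap.mulLeft ℝ x).IsSymmetric :=
  inner_mul_left x

lemma tr_mul (x y : V) : tr (x * y) = inner ℝ x y := by
  rw [tr, inner_mul_assoc, mul_one]

lemma tr_nonneg_of_idempotent {e : V} (he : e * e = e) : 0 ≤ tr e := by
  rw [← he, tr_mul]
  exact real_inner_self_nonneg

lemma jordan_linearized (a b c d : V) :
    a * ((b * c) * d) - (b * c) * (a * d) + (b * ((c * a) * d) - (c * a) * (b * d)) +
      (c * ((a * b) * d) - (a * b) * (c * d)) = 0 := by
  have h := DFunLike.congr_fun (two_nsmul_lie_lmul_lmul_add_add_eq_zero a b c) d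
  have : (2 : ℝ) • (a * ((b * c) * d) - (b * c) * (a * d) +
      (b * ((c * a) * d) - (c * a) * (b * d)) +
      (c * ((a * b) * d) - (a * b) * (c * d))) = 0 := by
    rw [two_smul, ← two_nsmul]
    exact h
  exact (smul_eq_zero.mp this).resolve_left two_ne_zero

lemma peirce_cubic {e : V} (he : e * e = e) (x : V) :
    (2 : ℝ) • (e * (e * (e * x))) - (3 : ℝ) • (e * (e * x)) + e * x = 0 := by
  have h := jordan_linearized e e x e
  rw [he, mul_comm x e, mul_comm (e * x) e, he, mul_comm x e] at h
  rw [← h]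
  module

/-- The operator `L` of multiplication by an idempotent satisfies `2 L³ - 3 L² + L = 0`, whence
`L = (2 L² - L)² + 8 (L² - L)²`. -/
lemma inner_mul_self_eq_of_idempotent {e : V} (he : e * e = e) (x : V) :
    inner ℝ (e * x) x =
      ‖(2 : ℝ) • (e * (e * x)) - e * x‖ ^ 2 + 8 * ‖e * (e * x) - e * x‖ ^ 2 := by
  have cubic := peirce_cubic he x
  have h₁ := congrArg (fun v => inner ℝ v x) cubic
  have h₂ := congrArg (fun v => inner ℝ v (e * x)) cubic
  simp only [inner_add_left, inner_sub_left, inner_smul_left, inner_zero_left, conj_trivial,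
    inner_mul_left e (e * (e * x)), inner_mul_left e (e * x) x] at h₁ h₂
  simp only [← real_inner_self_eq_norm_sq, inner_sub_left, inner_sub_right, inner_smul_left,
    inner_smul_right, conj_trivial, real_inner_comm (e * (e * x)) (e * x)]
  linarith

lemma inner_nonneg_of_idempotent {e q : V} (he : e * e = e) (hq : q * q = q) :
    0 ≤ inner ℝ e q := by
  rw [← hq, ← inner_mul_assoc, inner_mul_self_eq_of_idempotent he]
  positivity

lemma mulLeft_mul_mul (x y : V) :
    LinearMap.mulLeft ℝ (x * (x * y)) =
      (2 : ℝ) • (LinearMap.mulLeft ℝ (x * y) * LinearMap.mulLeft ℝ x) +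
        LinearMap.mulLeft ℝ (x * x) * LinearMap.mulLeft ℝ y -
        LinearMap.mulLeft ℝ y * (LinearMap.mulLeft ℝ x * LinearMap.mulLeft ℝ x) -
        LinearMap.mulLeft ℝ x * (LinearMap.mulLeft ℝ x * LinearMap.mulLeft ℝ y) := by
  ext c
  have h := jordan_linearized y x c x
  simp only [LinearMap.sub_apply, LinearMap.add_apply, LinearMap.smul_apply,
    Module.End.mul_apply, LinearMap.mulLeft_apply]
  rw [mul_comm y x, mul_comm (x * c) x, mul_comm (x * c) (x * y), mul_comm (c * y) x, mul_comm c y,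
    mul_comm (y * c) (x * x), mul_comm (x * y) x, mul_comm c (x * (x * y)), mul_comm c x] at h
  rw [← sub_eq_zero, ← h]
  module

/-- The elements `y` for which the multiplications by `y` and by `x * y` commute with those by `x`
and by `x * x`. This subspace is invariant under the multiplication by `x` and contains `1`, so it
contains all powers of `x`. -/
def operatorCommutant (x : V) : Submodule ℝ V :=
  let C := Subalgebra.toSubmodule
    (Subalgebra.centralizer ℝ {LinearMap.mulLeft ℝ x, LinearMap.mulLeft ℝ (x * x)})
  C.comap (LinearMap.mul ℝ V) ⊓ C.comap (LinearMap.mul ℝ V ∘ₗ LinearMap.mulLeft ℝ x)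

lemma mulLeft_mem_centralizer (x : V) :
    LinearMap.mulLeft ℝ x ∈
      Subalgebra.centralizer ℝ {LinearMap.mulLeft ℝ x, LinearMap.mulLeft ℝ (x * x)} := by
  rintro _ (rfl | rfl)
  · rfl
  · ext y
    exact IsJordan.lmul_lmul_comm_lmul x y

lemma mulLeft_mul_self_mem_centralizer (x : V) :
    LinearMap.mulLeft ℝ (x * x) ∈
      Subalgebra.centralizer ℝ {LinearMap.mulLeft ℝ x, LinearMap.mulLeft ℝ (x * x)} := by
  rintro _ (rfl | rfl)
  · exact (mulLeft_mem_centralizer x _ (.inr rfl)).symm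
  · rfl

lemma one_mem_operatorCommutant (x : V) : 1 ∈ operatorCommutant x := by
  refine ⟨?_, ?_⟩
  · have : LinearMap.mul ℝ V 1 = 1 := LinearMap.ext one_mul
    rw [SetLike.mem_coe, Submodule.mem_comap, this]
    exact one_mem (Subalgebra.centralizer ℝ _)
  · have : (LinearMap.mul ℝ V ∘ₗ LinearMap.mulLeft ℝ x) 1 = LinearMap.mulLeft ℝ x :=
      congrArg (LinearMap.mul ℝ V) (mul_one x)
    rw [SetLike.mem_coe, Submodule.mem_comap, this]
    exact mulLeft_mem_centralizer x

lemma mul_mem_operatorCommutant {x y : V} (hy : y ∈ operatorCommutant x) :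
    x * y ∈ operatorCommutant x := by
  obtain ⟨hy, hxy⟩ := hy
  have hx := mulLeft_mem_centralizer x
  refine ⟨hxy, ?_⟩
  have hxxy : LinearMap.mulLeft ℝ (x * (x * y)) ∈
      Subalgebra.centralizer ℝ {LinearMap.mulLeft ℝ x, LinearMap.mulLeft ℝ (x * x)} := by
    rw [mulLeft_mul_mul]
    exact sub_mem (sub_mem (add_mem (Subalgebra.smul_mem _ (mul_mem hxy hx) _)
      (mul_mem (mulLeft_mul_self_mem_centralizer x) hy)) (mul_mem hy (mul_mem hx hx)))
      (mul_mem hx (mul_mem hx hy))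
  exact hxxy

lemma mul_mul_comm_of_mem_operatorCommutant {x y : V} (hy : y ∈ operatorCommutant x) (z : V) :
    x * (y * z) = y * (x * z) :=
  LinearMap.congr_fun (hy.1 _ (.inl rfl)) z

lemma exists_sum_eigenvectors_eq_one (x : V) :
    ∃ c : ℝ →₀ V, (∀ t, c t ∈ operatorCommutant x) ∧ (∀ t, x * c t = t • c t) ∧
      c.sum (fun _ e => e) = 1 := by
  have hW : ∀ y ∈ operatorCommutant x, LinearMap.mulLeft ℝ x y ∈ operatorCommutant x :=
    fun _ => mul_mem_operatorCommutant
  have htop := Submodule.orthogonal_eq_bot_iff.mp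
    ((mulLeft_isSymmetric x).restrict_invariant hW).orthogonalComplement_iSup_eigenspaces_eq_bot
  have hone : (⟨1, one_mem_operatorCommutant x⟩ : operatorCommutant x) ∈
      ⨆ μ, Module.End.eigenspace ((LinearMap.mulLeft ℝ x).restrict hW) μ := by
    rw [htop]
    trivial
  obtain ⟨f, hf, hsum⟩ := (Submodule.mem_iSup_iff_exists_finsupp _ _).mp hone
  refine ⟨f.mapRange Subtype.val rfl, fun t => (f t).2, fun t => ?_, ?_⟩
  · exact congrArg Subtype.val (Module.End.mem_eigenspace_iff.mp (hf t))
  · rw [Finsupp.sum_mapRange_index (fun _ => rfl)]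
    simpa [Finsupp.sum] using congrArg Subtype.val hsum

lemma isSpectralDecomposition_of_eigenvectors {x : V} {c : ℝ →₀ V}
    (hmem : ∀ t, c t ∈ operatorCommutant x) (hc : ∀ t, x * c t = t • c t)
    (hsum : c.sum (fun _ e => e) = 1) : IsSpectralDecomposition x c := by
  have orthogonal : ∀ s t, s ≠ t → c s * c t = 0 := fun s t hst => by
    have hs := mul_mul_comm_of_mem_operatorCommutant (hmem s) (c t)
    have ht := mul_mul_comm_of_mem_operatorCommutant (hmem t) (c s)
    rw [hc, mul_smul_comm] at hs ht
    rw [mul_comm (c t), hs] at ht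
    by_contra h
    exact hst (smul_left_injective ℝ h ht).symm
  refine ⟨fun t => ?_, orthogonal, hsum, ?_⟩
  · by_cases ht : t ∈ c.support
    · conv_rhs => rw [← mul_one (c t), ← hsum, Finsupp.sum, Finset.mul_sum]
      rw [Finset.sum_eq_single_of_mem t ht (fun s _ hs => orthogonal t s hs.symm)]
    · rw [Finsupp.notMem_support_iff.mp ht, mul_zero]
  · conv_lhs => rw [← mul_one x, ← hsum, Finsupp.sum, Finset.mul_sum]
    exact Finset.sum_congr rfl fun t _ => hc t

theorem exists_isSpectralDecomposition (x : V) : ∃ c : ℝ →₀ V, IsSpectralDecomposition x c := by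
  obtain ⟨c, hmem, hc, hsum⟩ := exists_sum_eigenvectors_eq_one x
  exact ⟨c, isSpectralDecomposition_of_eigenvectors hmem hc hsum⟩

lemma IsSpectralDecomposition.mul_apply {x : V} {c : ℝ →₀ V} (h : IsSpectralDecomposition x c)
    (t : ℝ) : x * c t = t • c t := by
  rw [h.eq_sum, Finsupp.sum, Finset.sum_mul, Finset.sum_eq_single t]
  · rw [smul_mul_assoc, h.idempotent]
  · intro s _ hs
    rw [smul_mul_assoc, h.orthogonal s t hs, smul_zero]
  · intro ht
    rw [Finsupp.notMem_support_iff.mp ht, mul_zero]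

lemma inner_eq_zero_of_eigenvectors {x y z : V} {s t : ℝ} (hst : s ≠ t) (hy : x * y = s • y)
    (hz : x * z = t • z) : inner ℝ y z = 0 := by
  have h := inner_mul_left x y z
  rw [hy, hz, real_inner_smul_left, real_inner_smul_right] at h
  exact (mul_eq_mul_right_iff.mp h).resolve_left hst

lemma IsSpectralDecomposition.inner_apply_eq_tr {x : V} {c d : ℝ →₀ V}
    (hc : IsSpectralDecomposition x c) (hd : IsSpectralDecomposition x d) (t : ℝ) :
    inner ℝ (c t) (d t) = tr (c t) := by
  rw [tr, ← hd.complete, Finsupp.sum, inner_sum, Finset.sum_eq_single t]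
  · exact fun s _ hs => inner_eq_zero_of_eigenvectors hs.symm (hc.mul_apply t) (hd.mul_apply s)
  · intro ht
    rw [Finsupp.notMem_support_iff.mp ht, inner_zero_right]

theorem IsSpectralDecomposition.unique {x : V} {c d : ℝ →₀ V} (hc : IsSpectralDecomposition x c)
    (hd : IsSpectralDecomposition x d) : c = d := by
  ext t
  rw [← sub_eq_zero, ← inner_self_eq_zero (𝕜 := ℝ), inner_sub_left, inner_sub_right,
    inner_sub_right, hc.inner_apply_eq_tr hc, hc.inner_apply_eq_tr hd, hd.inner_apply_eq_tr hc,
    hd.inner_apply_eq_tr hd, sub_self, sub_self, sub_self]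

lemma spectral_isSpectralDecomposition (x : V) : IsSpectralDecomposition x (spectral x) := by
  rw [spectral, dif_pos (exists_isSpectralDecomposition x)]
  exact (exists_isSpectralDecomposition x).choose_spec

lemma spectral_mul_self (x : V) (t : ℝ) : spectral x t * spectral x t = spectral x t :=
  (spectral_isSpectralDecomposition x).idempotent t

lemma mul_spectral (x : V) (t : ℝ) : x * spectral x t = t • spectral x t :=
  (spectral_isSpectralDecomposition x).mul_apply t

lemma sum_spectral (x : V) : ∑ t ∈ (spectral x).support, spectral x t = 1 :=
  (spectral_isSpectralDecomposition x).complete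

end SpectralTheorem

section FunctionalCalculus

lemma funCalc_eq_sum (f : ℝ → ℝ) (x : V) :
    funCalc f x = ∑ t ∈ (spectral x).support, f t • spectral x t := rfl

lemma funCalc_id (x : V) : funCalc (fun t => t) x = x :=
  ((spectral_isSpectralDecomposition x).eq_sum).symm

lemma funCalc_const (r : ℝ) (x : V) : funCalc (fun _ => r) x = r • 1 := by
  rw [funCalc_eq_sum, ← Finset.smul_sum, sum_spectral]

lemma funCalc_congr {f g : ℝ → ℝ} {x : V} (h : ∀ t ∈ (spectral x).support, f t = g t) :
    funCalc f x = funCalc g x :=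
  Finset.sum_congr rfl fun t ht => by simp only [h t ht]

lemma funCalc_add (f g : ℝ → ℝ) (x : V) :
    funCalc (fun t => f t + g t) x = funCalc f x + funCalc g x := by
  simp only [funCalc_eq_sum, add_smul, Finset.sum_add_distrib]

lemma funCalc_sub (f g : ℝ → ℝ) (x : V) :
    funCalc (fun t => f t - g t) x = funCalc f x - funCalc g x := by
  simp only [funCalc_eq_sum, sub_smul, Finset.sum_sub_distrib]

lemma funCalc_const_mul (r : ℝ) (f : ℝ → ℝ) (x : V) :
    funCalc (fun t => r * f t) x = r • funCalc f x := by
  simp only [funCalc_eq_sum, Finset.smul_sum, smul_smul]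

lemma funCalc_mul (f g : ℝ → ℝ) (x : V) :
    funCalc (fun t => f t * g t) x = funCalc f x * funCalc g x := by
  simp only [funCalc_eq_sum, Finset.sum_mul_sum, smul_mul_smul_comm]
  refine Finset.sum_congr rfl fun s hs => ?_
  rw [Finset.sum_eq_single_of_mem s hs, spectral_mul_self]
  intro t _ hts
  rw [(spectral_isSpectralDecomposition x).orthogonal s t hts.symm, smul_zero]

lemma spectral_apply_eq_funCalc (x : V) (t : ℝ) :
    spectral x t = funCalc (fun s => if s = t then 1 else 0) x := by
  simp only [funCalc_eq_sum, ite_smul, one_smul, zero_smul, Finset.sum_ite_eq']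
  split_ifs with h
  · rfl
  · exact Finsupp.notMem_support_iff.mp h

lemma funCalc_mul_spectral (f : ℝ → ℝ) (x : V) (t : ℝ) :
    funCalc f x * spectral x t = f t • spectral x t := by
  rw [spectral_apply_eq_funCalc, ← funCalc_mul, ← funCalc_const_mul]
  refine funCalc_congr fun s _ => ?_
  split_ifs with h
  · rw [h]
  · rw [mul_zero, mul_zero]

lemma mapDomain_spectral_apply (φ : ℝ → ℝ) (x : V) (t : ℝ) :
    (spectral x).mapDomain φ t = funCalc (fun s => if φ s = t then 1 else 0) x := by
  rw [Finsupp.mapDomain, Finsupp.sum_apply]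
  refine Finset.sum_congr rfl fun s _ => ?_
  simp only [Finsupp.single_apply, ite_smul, one_smul, zero_smul]

theorem spectral_funCalc (φ : ℝ → ℝ) (x : V) :
    spectral (funCalc φ x) = (spectral x).mapDomain φ := by
  refine (spectral_isSpectralDecomposition _).unique ⟨fun t => ?_, fun s t hst => ?_, ?_, ?_⟩
  · simp only [mapDomain_spectral_apply, ← funCalc_mul, mul_ite, mul_one, mul_zero]
    refine funCalc_congr fun r _ => ?_
    split_ifs <;> rfl
  · simp only [mapDomain_spectral_apply, ← funCalc_mul]
    rw [← zero_smul ℝ (1 : V), ← funCalc_const 0 x]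
    refine funCalc_congr fun r _ => ?_
    split_ifs with hs ht
    · exact absurd (hs.symm.trans ht) hst
    all_goals norm_num
  · rw [Finsupp.sum_mapDomain_index (fun _ => rfl) (fun _ _ _ => rfl)]
    exact sum_spectral x
  · rw [Finsupp.sum_mapDomain_index smul_zero smul_add]
    rfl

theorem funCalc_funCalc (f φ : ℝ → ℝ) (x : V) :
    funCalc f (funCalc φ x) = funCalc (fun t => f (φ t)) x := by
  rw [funCalc, spectral_funCalc,
    Finsupp.sum_mapDomain_index (fun _ => smul_zero _) (fun _ => smul_add _)]
  rfl

lemma add_smul_one_eq_funCalc (x : V) (r : ℝ) : x + r • 1 = funCalc (fun t => t + r) x := by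
  rw [funCalc_add, funCalc_id, funCalc_const]

lemma smul_eq_funCalc (r : ℝ) (x : V) : r • x = funCalc (fun t => r * t) x := by
  rw [funCalc_const_mul, funCalc_id]

lemma tendsto_funCalc {ι : Type*} {l : Filter ι} {F : ι → ℝ → ℝ} {f : ℝ → ℝ} {x : V}
    (h : ∀ t ∈ (spectral x).support, Tendsto (fun i => F i t) l (𝓝 (f t))) :
    Tendsto (fun i => funCalc (F i) x) l (𝓝 (funCalc f x)) := by
  simp only [funCalc_eq_sum]
  exact tendsto_finsetSum _ fun t ht => (h t ht).smul_const _

end FunctionalCalculus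

section TraceFunctions

/-- The trace function `tr f(x)` associated with a real function `f`. -/
noncomputable def trFun (f : ℝ → ℝ) (x : V) : ℝ := tr (funCalc f x)

lemma trFun_eq_sum (f : ℝ → ℝ) (x : V) :
    trFun f x = ∑ t ∈ (spectral x).support, f t * tr (spectral x t) := by
  simp only [trFun, tr, funCalc_eq_sum, sum_inner, real_inner_smul_left]

lemma trFun_congr {f g : ℝ → ℝ} {x : V} (h : ∀ t ∈ (spectral x).support, f t = g t) :
    trFun f x = trFun g x := by
  rw [trFun, funCalc_congr h, trFun]

lemma trFun_const (r : ℝ) (x : V) : trFun (fun _ => r) x = r * tr (1 : V) := by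
  rw [trFun, funCalc_const, tr, real_inner_smul_left, tr]

lemma trFun_sub (f g : ℝ → ℝ) (x : V) :
    trFun (fun t => f t - g t) x = trFun f x - trFun g x := by
  simp only [trFun_eq_sum, sub_mul, Finset.sum_sub_distrib]

lemma trFun_const_mul (r : ℝ) (f : ℝ → ℝ) (x : V) :
    trFun (fun t => r * f t) x = r * trFun f x := by
  rw [trFun, funCalc_const_mul, tr, real_inner_smul_left, trFun, tr]

lemma trFun_mul (f g : ℝ → ℝ) (x : V) :
    trFun (fun t => f t * g t) x = inner ℝ (funCalc f x) (funCalc g x) := by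
  rw [trFun, funCalc_mul, tr_mul]

lemma tr_spectral_pos {x : V} {t : ℝ} (ht : t ∈ (spectral x).support) : 0 < tr (spectral x t) := by
  rw [← spectral_mul_self, tr_mul]
  exact real_inner_self_pos.mpr (Finsupp.mem_support_iff.mp ht)

lemma trFun_mono {f g : ℝ → ℝ} {x : V} (h : ∀ t ∈ (spectral x).support, f t ≤ g t) :
    trFun f x ≤ trFun g x := by
  simp only [trFun_eq_sum]
  exact Finset.sum_le_sum fun t ht =>
    mul_le_mul_of_nonneg_right (h t ht) (tr_nonneg_of_idempotent (spectral_mul_self x t))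

lemma trFun_nonneg {f : ℝ → ℝ} {x : V} (h : ∀ t ∈ (spectral x).support, 0 ≤ f t) :
    0 ≤ trFun f x := by
  have := trFun_mono h
  rwa [trFun_const, zero_mul] at this

lemma trFun_add_smul_one (f : ℝ → ℝ) (x : V) (r : ℝ) :
    trFun f (x + r • 1) = trFun (fun t => f (t + r)) x := by
  rw [trFun, add_smul_one_eq_funCalc, funCalc_funCalc, trFun]

lemma tendsto_trFun {ι : Type*} {l : Filter ι} {F : ι → ℝ → ℝ} {f : ℝ → ℝ} {x : V}
    (h : ∀ t ∈ (spectral x).support, Tendsto (fun i => F i t) l (𝓝 (f t))) :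
    Tendsto (fun i => trFun (F i) x) l (𝓝 (trFun f x)) :=
  (tendsto_funCalc h).inner tendsto_const_nhds

lemma norm_funCalc_le {f : ℝ → ℝ} {M : ℝ} (hM : 0 ≤ M) (x : V)
    (h : ∀ t ∈ (spectral x).support, |f t| ≤ M) : ‖funCalc f x‖ ≤ M * ‖(1 : V)‖ := by
  refine le_of_sq_le_sq ?_ (by positivity)
  calc ‖funCalc f x‖ ^ 2 = trFun (fun t => f t * f t) x := by
        rw [trFun_mul, real_inner_self_eq_norm_sq]
    _ ≤ trFun (fun _ => M * M) x := trFun_mono fun t ht => by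
        rw [← abs_mul_abs_self]
        exact mul_self_le_mul_self (abs_nonneg _) (h t ht)
    _ = (M * ‖(1 : V)‖) ^ 2 := by
        rw [trFun_const, tr, real_inner_self_eq_norm_sq]
        ring

/-- The sum of `F s t` over the eigenvalues `s` of `x` and `t` of `y`, weighted by the inner
products of their spectral idempotents. As the weights are nonnegative, inequalities between scalar
functions of two variables become inequalities between `x` and `y`. -/
noncomputable def pairSum (x y : V) (F : ℝ → ℝ → ℝ) : ℝ :=
  ∑ s ∈ (spectral x).support, ∑ t ∈ (spectral y).support,
    F s t * inner ℝ (spectral x s) (spectral y t)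

lemma pairSum_mono {x y : V} {F G : ℝ → ℝ → ℝ}
    (h : ∀ s ∈ (spectral x).support, ∀ t ∈ (spectral y).support, F s t ≤ G s t) :
    pairSum x y F ≤ pairSum x y G :=
  Finset.sum_le_sum fun s hs => Finset.sum_le_sum fun t ht =>
    mul_le_mul_of_nonneg_right (h s hs t ht)
      (inner_nonneg_of_idempotent (spectral_mul_self x s) (spectral_mul_self y t))

lemma pairSum_sub (x y : V) (F G : ℝ → ℝ → ℝ) :
    pairSum x y (fun s t => F s t - G s t) = pairSum x y F - pairSum x y G := by
  simp only [pairSum, sub_mul, Finset.sum_sub_distrib]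

lemma pairSum_const_mul (x y : V) (r : ℝ) (F : ℝ → ℝ → ℝ) :
    pairSum x y (fun s t => r * F s t) = r * pairSum x y F := by
  simp only [pairSum, mul_assoc, Finset.mul_sum]

lemma pairSum_mul (f g : ℝ → ℝ) (x y : V) :
    pairSum x y (fun s t => f s * g t) = inner ℝ (funCalc f x) (funCalc g y) := by
  rw [funCalc_eq_sum, sum_inner]
  refine Finset.sum_congr rfl fun s _ => ?_
  rw [real_inner_smul_left, funCalc_eq_sum, inner_sum, Finset.mul_sum]
  simp only [real_inner_smul_right, mul_assoc]

lemma pairSum_left (f : ℝ → ℝ) (x y : V) : pairSum x y (fun s _ => f s) = trFun f x := by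
  have := pairSum_mul f (fun _ => 1) x y
  rwa [funCalc_const, one_smul, ← tr, ← trFun, funext₂ fun s _ => mul_one (f s)] at this

lemma pairSum_right (g : ℝ → ℝ) (x y : V) : pairSum x y (fun _ t => g t) = trFun g y := by
  have := pairSum_mul (fun _ => 1) g x y
  rwa [funCalc_const, one_smul, real_inner_comm, ← tr, ← trFun,
    funext₂ fun _ t => one_mul (g t)] at this

lemma pairSum_mul_sub (g : ℝ → ℝ) (x y : V) :
    pairSum x y (fun s t => g t * (s - t)) = inner ℝ (funCalc g y) (x - y) := by
  calc pairSum x y (fun s t => g t * (s - t))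
      = pairSum x y (fun s t => s * g t - g t * t) := by simp only [mul_sub, mul_comm]
    _ = inner ℝ x (funCalc g y) - inner ℝ (funCalc g y) y := by
        rw [pairSum_sub, pairSum_mul (fun s => s), pairSum_right (fun t => g t * t), trFun_mul,
          funCalc_id, funCalc_id]
    _ = inner ℝ (funCalc g y) (x - y) := by rw [inner_sub_right, real_inner_comm]

lemma pairSum_sub_sq (f : ℝ → ℝ) (x y : V) :
    pairSum x y (fun s t => (f s - f t) ^ 2) = ‖funCalc f x - funCalc f y‖ ^ 2 := by
  calc pairSum x y (fun s t => (f s - f t) ^ 2)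
      = pairSum x y (fun s t => f s * f s - (2 * (f s * f t) - f t * f t)) := by
        congr! 3
        ring
    _ = ‖funCalc f x - funCalc f y‖ ^ 2 := by
        rw [pairSum_sub, pairSum_sub, pairSum_const_mul, pairSum_mul,
          pairSum_left (fun s => f s * f s), pairSum_right (fun t => f t * f t), trFun_mul,
          trFun_mul, norm_sub_sq_real, real_inner_self_eq_norm_sq, real_inner_self_eq_norm_sq]
        ring

theorem lipschitzOnWith_funCalc {f : ℝ → ℝ} {K : ℝ≥0} {S : Set ℝ} (hf : LipschitzOnWith K f S) :
    LipschitzOnWith K (funCalc f) {x : V | ↑(spectral x).support ⊆ S} := by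
  refine LipschitzOnWith.of_dist_le_mul fun x hx y hy => ?_
  rw [dist_eq_norm, dist_eq_norm]
  refine le_of_sq_le_sq ?_ (by positivity)
  have hid := pairSum_sub_sq (fun t => t) x y
  rw [funCalc_id, funCalc_id] at hid
  rw [mul_pow, ← pairSum_sub_sq, ← hid, ← pairSum_const_mul]
  refine pairSum_mono fun s hs t ht => ?_
  rw [← mul_pow, sq_le_sq, abs_mul, NNReal.abs_eq]
  exact hf.dist_le_mul s (hx hs) t (hy ht)

lemma continuous_funCalc {f : ℝ → ℝ} {K : ℝ≥0} (hf : LipschitzWith K f) :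
    Continuous (funCalc f : V → V) := by
  have h := lipschitzOnWith_funCalc (V := V) (lipschitzOnWith_univ.mpr hf)
  simp only [subset_univ, ofPred_true, lipschitzOnWith_univ] at h
  exact h.continuous

lemma continuous_trFun {f : ℝ → ℝ} {K : ℝ≥0} (hf : LipschitzWith K f) :
    Continuous (trFun f : V → ℝ) :=
  (continuous_funCalc hf).inner continuous_const

lemma abs_sub_sub_mul_le {f f' : ℝ → ℝ} {K : ℝ≥0} {I : Set ℝ} (hI : Convex ℝ I)
    (hf : ∀ t ∈ I, HasDerivAt f (f' t) t) (hf' : LipschitzOnWith K f' I) {s t : ℝ} (hs : s ∈ I)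
    (ht : t ∈ I) : |f s - f t - f' t * (s - t)| ≤ K * (s - t) ^ 2 := by
  have hsub : uIcc t s ⊆ I := hI.ordConnected.uIcc_subset ht hs
  have hderiv : ∀ u ∈ uIcc t s,
      HasDerivWithinAt (fun u => f u - f' t * u) (f' u - f' t) (uIcc t s) u := fun u hu => by
    simpa using ((hf u (hsub hu)).fun_sub ((hasDerivAt_id u).const_mul (f' t))).hasDerivWithinAt
  have hbound : ∀ u ∈ uIcc t s, ‖f' u - f' t‖ ≤ K * |s - t| := fun u hu =>
    (hf'.norm_sub_le (hsub hu) ht).trans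
      (mul_le_mul_of_nonneg_left (abs_sub_left_of_mem_uIcc hu) K.2)
  have := (convex_uIcc t s).norm_image_sub_le_of_norm_hasDerivWithin_le hderiv hbound
    left_mem_uIcc right_mem_uIcc
  rw [Real.norm_eq_abs, Real.norm_eq_abs, mul_assoc, abs_mul_abs_self, ← sq] at this
  convert this using 2
  ring

theorem abs_trFun_sub_le {f f' : ℝ → ℝ} {K : ℝ} {x y : V}
    (h : ∀ s ∈ (spectral x).support, ∀ t ∈ (spectral y).support,
      |f s - f t - f' t * (s - t)| ≤ K * (s - t) ^ 2) :
    |trFun f x - trFun f y - inner ℝ (funCalc f' y) (x - y)| ≤ K * ‖x - y‖ ^ 2 := by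
  have hid := pairSum_sub_sq (fun t => t) x y
  rw [funCalc_id, funCalc_id] at hid
  rw [← pairSum_mul_sub, ← pairSum_left f x y, ← pairSum_right f x y, ← pairSum_sub, ← pairSum_sub,
    ← hid, ← pairSum_const_mul, abs_le]
  constructor
  · rw [neg_eq_neg_one_mul, ← pairSum_const_mul]
    exact pairSum_mono fun s hs t ht => by linarith [neg_le_of_abs_le (h s hs t ht)]
  · exact pairSum_mono fun s hs t ht => le_of_abs_le (h s hs t ht)

theorem hasFDerivAt_trFun {f f' : ℝ → ℝ} {K : ℝ≥0} {I : Set ℝ} (hI : Convex ℝ I)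
    (hf : ∀ t ∈ I, HasDerivAt f (f' t) t) (hf' : LipschitzOnWith K f' I) {x : V}
    (hx : ∀ᶠ y in 𝓝 x, ↑(spectral y).support ⊆ I) :
    HasFDerivAt (trFun f) (innerSL ℝ (funCalc f' x)) x := by
  refine .of_isLittleO ?_
  refine Asymptotics.IsBigO.trans_isLittleO (g := fun y => ‖y - x‖ ^ 2) ?_ ?_
  · refine .of_bound K (hx.mono fun y hy => ?_)
    rw [norm_pow, norm_norm]
    exact abs_trFun_sub_le fun s hs t ht =>
      abs_sub_sub_mul_le hI hf hf' (hy hs) (hx.self_of_nhds ht)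
  · exact Asymptotics.isLittleO_pow_sub_sub x one_lt_two

end TraceFunctions

section NegativePart

/-- The trace of the negative part of `x`. -/
noncomputable def trNeg (x : V) : ℝ := trFun (fun t => max (-t) 0) x

lemma trNeg_nonneg (x : V) : 0 ≤ trNeg x := trFun_nonneg fun _ _ => le_max_right _ _

lemma continuous_trNeg : Continuous (trNeg : V → ℝ) :=
  continuous_trFun (LipschitzWith.id.neg.max_const 0)

/-- The negative part has the variational formula `tr x⁻ = max ⟪g, x⟫` over `-1 ≤ g ≤ 0`; for
`x + y` the maximum is attained at `g = -1_{(-∞, 0)}(x + y)`. -/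
theorem trNeg_add_le (x y : V) : trNeg (x + y) ≤ trNeg x + trNeg y := by
  let g : ℝ → ℝ := fun t => if t < 0 then -1 else 0
  have inner_le (z : V) : inner ℝ (funCalc g (x + y)) z ≤ trNeg z := by
    have hz := pairSum_mul (fun s => s) g z (x + y)
    rw [funCalc_id, real_inner_comm] at hz
    rw [← hz, trNeg, ← pairSum_left _ z (x + y)]
    refine pairSum_mono fun s _ t _ => ?_
    simp only [g]
    split_ifs
    · simp
    · simp
  calc trNeg (x + y) = inner ℝ (funCalc g (x + y)) (x + y) := by
        have h := trFun_mul g (fun t => t) (x + y)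
        rw [funCalc_id] at h
        rw [← h, trNeg]
        refine trFun_congr fun t _ => ?_
        simp only [g]
        split_ifs with ht
        · rw [max_eq_left (by linarith), neg_one_mul]
        · rw [max_eq_right (by linarith), zero_mul]
    _ = inner ℝ (funCalc g (x + y)) x + inner ℝ (funCalc g (x + y)) y := inner_add_right _ _ _
    _ ≤ trNeg x + trNeg y := add_le_add (inner_le x) (inner_le y)

end NegativePart

section Order

/-- The multiplication operators, as bounded operators depending continuously on the multiplier. -/
noncomputable def mulLeftL : V →L[ℝ] V →L[ℝ] V :=
  LinearMap.toContinuousLinearMap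
    (LinearMap.toContinuousLinearMap.toLinearMap ∘ₗ LinearMap.mul ℝ V)

lemma mulLeftL_apply (x y : V) : mulLeftL x y = x * y := rfl

/-- The inequality `δ • 1 ≤ x`, tested against idempotents. -/
def AtLeast (δ : ℝ) (x : V) : Prop := ∀ e : V, e * e = e → δ * tr e ≤ inner ℝ x e

lemma AtLeast.mono {δ ε : ℝ} {x : V} (hx : AtLeast δ x) (h : ε ≤ δ) : AtLeast ε x :=
  fun e he => (mul_le_mul_of_nonneg_right h (tr_nonneg_of_idempotent he)).trans (hx e he)

lemma AtLeast.add {δ ε : ℝ} {x y : V} (hx : AtLeast δ x) (hy : AtLeast ε y) :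
    AtLeast (δ + ε) (x + y) := fun e he => by
  rw [inner_add_left, add_mul]
  exact add_le_add (hx e he) (hy e he)

lemma AtLeast.smul {δ r : ℝ} {x : V} (hx : AtLeast δ x) (hr : 0 ≤ r) :
    AtLeast (r * δ) (r • x) := fun e he => by
  rw [real_inner_smul_left, mul_assoc]
  exact mul_le_mul_of_nonneg_left (hx e he) hr

lemma atLeast_smul_one (r : ℝ) : AtLeast r (r • (1 : V)) := fun e _ => by
  rw [real_inner_smul_left, real_inner_comm, tr]

lemma atLeast_zero_of_mem_positiveCone {x : V} (hx : x ∈ positiveCone V) : AtLeast 0 x := by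
  obtain ⟨y, rfl⟩ := hx
  intro e he
  rw [zero_mul, inner_mul_assoc, mul_comm, real_inner_comm, inner_mul_self_eq_of_idempotent he]
  positivity

lemma atLeast_iff {δ : ℝ} {x : V} : AtLeast δ x ↔ ∀ t ∈ (spectral x).support, δ ≤ t := by
  refine ⟨fun h t ht => ?_, fun h e he => ?_⟩
  · have hinner : inner ℝ x (spectral x t) = t * tr (spectral x t) := by
      rw [← tr_mul, mul_spectral, tr, real_inner_smul_left, tr]
    exact le_of_mul_le_mul_right (hinner ▸ h _ (spectral_mul_self x t)) (tr_spectral_pos ht)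
  · have hx : inner ℝ x e = ∑ t ∈ (spectral x).support, t * inner ℝ (spectral x t) e := by
      conv_lhs => rw [← funCalc_id x]
      simp only [funCalc_eq_sum, sum_inner, real_inner_smul_left]
    rw [hx, tr, real_inner_comm, ← sum_spectral x, sum_inner, Finset.mul_sum]
    exact Finset.sum_le_sum fun t ht => mul_le_mul_of_nonneg_right (h t ht)
      (inner_nonneg_of_idempotent (spectral_mul_self x t) he)

lemma atLeast_neg_norm_mulLeftL (x : V) : AtLeast (-‖mulLeftL x‖) x := fun e he => by
  have hxe : inner ℝ x e = inner ℝ (mulLeftL x e) e := by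
    rw [mulLeftL_apply, inner_mul_assoc, he]
  have hnorm : |inner ℝ (mulLeftL x e) e| ≤ ‖mulLeftL x‖ * tr e := by
    rw [← he, tr_mul, he, real_inner_self_eq_norm_mul_norm, ← mul_assoc]
    exact (abs_real_inner_le_norm _ _).trans
      (mul_le_mul_of_nonneg_right ((mulLeftL x).le_opNorm e) (norm_nonneg e))
  rw [hxe, neg_mul]
  exact neg_le_of_abs_le hnorm

lemma AtLeast.eventually {δ ε : ℝ} {x : V} (hx : AtLeast δ x) (h : ε < δ) :
    ∀ᶠ y in 𝓝 x, AtLeast ε y := by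
  have hcont : Tendsto (fun y : V => ‖mulLeftL (y - x)‖) (𝓝 x) (𝓝 0) := by
    have : Continuous fun y : V => ‖mulLeftL (y - x)‖ := by fun_prop
    simpa using this.tendsto x
  filter_upwards [hcont.eventually_lt_const (sub_pos.mpr h)] with y hy
  rw [← add_sub_cancel x y]
  exact (hx.add (atLeast_neg_norm_mulLeftL (y - x))).mono (by linarith)

/-- Positive definite elements, bounded below by a positive multiple of the unit. -/
def PosDef (x : V) : Prop := ∃ δ > 0, AtLeast δ x

lemma AtLeast.posDef_add {x y : V} (hx : AtLeast 0 x) (hy : PosDef y) : PosDef (x + y) := by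
  obtain ⟨δ, hδ, hy⟩ := hy
  exact ⟨0 + δ, by rwa [zero_add], hx.add hy⟩

lemma PosDef.atLeast_zero {x : V} (hx : PosDef x) : AtLeast 0 x := by
  obtain ⟨δ, hδ, hx⟩ := hx
  exact hx.mono hδ.le

lemma PosDef.add {x y : V} (hx : PosDef x) (hy : PosDef y) : PosDef (x + y) :=
  hx.atLeast_zero.posDef_add hy

lemma PosDef.smul {x : V} (hx : PosDef x) {r : ℝ} (hr : 0 < r) : PosDef (r • x) := by
  obtain ⟨δ, hδ, hx⟩ := hx
  exact ⟨r * δ, mul_pos hr hδ, hx.smul hr.le⟩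

lemma posDef_smul_one {r : ℝ} (hr : 0 < r) : PosDef (r • (1 : V)) :=
  ⟨r, hr, atLeast_smul_one r⟩

lemma posDef_iff {x : V} : PosDef x ↔ ∀ t ∈ (spectral x).support, 0 < t := by
  refine ⟨fun ⟨δ, hδ, h⟩ t ht => hδ.trans_le (atLeast_iff.mp h t ht), fun h => ?_⟩
  obtain hs | hs := (spectral x).support.eq_empty_or_nonempty
  · exact ⟨1, one_pos, atLeast_iff.mpr (by simp [hs])⟩
  · exact ⟨_, h _ (Finset.min'_mem _ hs), atLeast_iff.mpr (Finset.min'_le _)⟩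

end Order

section ScalarApproximation

lemma lipschitzOnWith_log {δ : ℝ} (hδ : 0 < δ) :
    LipschitzOnWith δ⁻¹.toNNReal Real.log (Ici δ) := by
  refine (convex_Ici δ).lipschitzOnWith_of_nnnorm_hasDerivWithin_le
    (fun t ht => (Real.hasDerivAt_log (hδ.trans_le ht).ne').hasDerivWithinAt) fun t ht => ?_
  have ht0 : 0 < t := hδ.trans_le ht
  rw [← NNReal.coe_le_coe, coe_nnnorm, Real.coe_toNNReal _ (by positivity), norm_inv,
    Real.norm_of_nonneg ht0.le]
  exact inv_anti₀ hδ ht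

lemma lipschitzOnWith_inv {δ : ℝ} (hδ : 0 < δ) :
    LipschitzOnWith (δ ^ 2)⁻¹.toNNReal (fun t : ℝ => t⁻¹) (Ici δ) := by
  refine (convex_Ici δ).lipschitzOnWith_of_nnnorm_hasDerivWithin_le
    (fun t ht => (hasDerivAt_inv (hδ.trans_le ht).ne').hasDerivWithinAt) fun t ht => ?_
  have ht0 : 0 < t := hδ.trans_le ht
  rw [← NNReal.coe_le_coe, coe_nnnorm, Real.coe_toNNReal _ (by positivity), norm_neg, norm_inv,
    norm_pow, Real.norm_of_nonneg ht0.le]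
  exact inv_anti₀ (by positivity) (pow_le_pow_left₀ hδ.le ht 2)

/-- A smooth approximation of the sign function. As `t * f'(t)` is bounded by `1 / log n` uniformly
in `t`, it is almost constant along multiplicative flows. -/
noncomputable def smoothSign (n t : ℝ) : ℝ := (Real.log n)⁻¹ * Real.arsinh (n * t)

lemma hasDerivAt_smoothSign (n t : ℝ) :
    HasDerivAt (smoothSign n) ((Real.log n)⁻¹ * ((√(1 + (n * t) ^ 2))⁻¹ * n)) t := by
  have hn : HasDerivAt (fun t => n * t) n t := by simpa using (hasDerivAt_id t).const_mul n
  exact hn.arsinh.const_mul (Real.log n)⁻¹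

lemma lipschitzWith_inv_sqrt : LipschitzWith 1 fun t : ℝ => (√(1 + t ^ 2))⁻¹ := by
  have hderiv (t : ℝ) : HasDerivAt (fun t : ℝ => (√(1 + t ^ 2))⁻¹)
      (-(t / √(1 + t ^ 2)) / √(1 + t ^ 2) ^ 2) t := by
    have h : HasDerivAt (fun t : ℝ => 1 + t ^ 2) (2 * t) t := by
      simpa using (hasDerivAt_pow 2 t).const_add 1
    rw [← mul_div_mul_left t (√(1 + t ^ 2)) two_ne_zero]
    exact (h.sqrt (by positivity)).fun_inv (by positivity)
  refine lipschitzWith_of_nnnorm_deriv_le (fun t => (hderiv t).differentiableAt) fun t => ?_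
  rw [← NNReal.coe_le_coe, coe_nnnorm, (hderiv t).deriv]
  have habs : |t| ≤ √(1 + t ^ 2) := Real.abs_le_sqrt (by linarith)
  have hone : 1 ≤ √(1 + t ^ 2) := Real.one_le_sqrt.mpr (by linarith [sq_nonneg t])
  rw [norm_div, norm_neg, norm_div, Real.norm_eq_abs t, norm_pow,
    Real.norm_of_nonneg (by positivity)]
  exact div_le_one_of_le₀ ((div_le_one_of_le₀ habs (by positivity)).trans (one_le_pow₀ hone))
    (by positivity)

lemma tendsto_smoothSign (t : ℝ) : Tendsto (fun n => smoothSign n t) atTop (𝓝 (Real.sign t)) := by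
  have main {t : ℝ} (ht : 0 < t) : Tendsto (fun n => smoothSign n t) atTop (𝓝 1) := by
    have hlog : Tendsto (fun n : ℝ => (Real.log n)⁻¹ * Real.log (t + √((n⁻¹) ^ 2 + t ^ 2))) atTop
        (𝓝 (0 * Real.log (t + √(0 ^ 2 + t ^ 2)))) := by
      refine Real.tendsto_log_atTop.inv_tendsto_atTop.mul (Tendsto.log ?_ (by positivity))
      exact (((tendsto_inv_atTop_zero.pow 2).add_const _).sqrt).const_add t
    rw [zero_mul] at hlog
    have h1 := hlog.const_add 1
    rw [add_zero] at h1
    refine h1.congr' ?_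
    filter_upwards [eventually_gt_atTop 1] with n hn
    have hn0 : 0 < n := one_pos.trans hn
    have hfac : n * t + √(1 + (n * t) ^ 2) = n * (t + √((n⁻¹) ^ 2 + t ^ 2)) := by
      have : 1 + (n * t) ^ 2 = n ^ 2 * ((n⁻¹) ^ 2 + t ^ 2) := by field_simp
      rw [this, Real.sqrt_mul (sq_nonneg n), Real.sqrt_sq hn0.le, mul_add]
    rw [smoothSign, Real.arsinh, hfac, Real.log_mul (by positivity) (by positivity), mul_add,
      inv_mul_cancel₀ (Real.log_pos hn).ne']
  rcases lt_trichotomy t 0 with ht | rfl | ht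
  · rw [Real.sign_of_neg ht]
    refine (main (neg_pos.mpr ht)).neg.congr fun n => ?_
    rw [smoothSign, smoothSign, mul_neg, Real.arsinh_neg, mul_neg, neg_neg]
  · simp [smoothSign]
  · rw [Real.sign_of_pos ht]
    exact main ht

end ScalarApproximation

section Flow

lemma exp_apply_of_eigenvector {E : Type*} [NormedAddCommGroup E] [NormedSpace ℝ E]
    [CompleteSpace E] {A : E →L[ℝ] E} {q : E} {μ : ℝ} (h : A q = μ • q) :
    NormedSpace.exp A q = Real.exp μ • q := by
  have hpow (n : ℕ) : (A ^ n) q = μ ^ n • q := by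
    induction n with
    | zero => simp
    | succ n ih => rw [pow_succ, mul_apply_eq_comp, h, map_smul, ih, smul_smul, pow_succ']
  have hA := (ContinuousLinearMap.apply ℝ E q).hasSum
    (NormedSpace.exp_series_hasSum_exp' (𝕂 := ℝ) A)
  have hμ := (NormedSpace.exp_series_hasSum_exp' (𝕂 := ℝ) μ).smul_const q
  rw [← Real.exp_eq_exp_ℝ] at hμ
  refine hA.unique (hμ.congr_fun fun n => ?_)
  simp [hpow, smul_smul]

/-- The one-parameter group `s ↦ exp (s L_a)`, where `L_a` is multiplication by `a`. The operator
`flow a s` is the quadratic representation of `exp (s a / 2)`; for matrices it maps `y` to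
`exp (s a / 2) y exp (s a / 2)`. -/
noncomputable def flow (a : V) (s : ℝ) : V →L[ℝ] V := NormedSpace.exp (s • mulLeftL a)

lemma flow_zero (a y : V) : flow a 0 y = y := by
  rw [flow, zero_smul, NormedSpace.exp_zero, one_apply_eq_self]

lemma hasDerivAt_flow (a y : V) (s : ℝ) :
    HasDerivAt (fun s => flow a s y) (a * flow a s y) s := by
  have : CompleteSpace V := FiniteDimensional.complete ℝ V
  have h := (hasDerivAt_exp_smul_const' (𝕂 := ℝ) (mulLeftL a) s).clm_apply (hasDerivAt_const s y)
  simpa [flow, mulLeftL_apply] using h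

lemma flow_one_of_eigenvector {a q : V} {μ : ℝ} (h : a * q = μ • q) :
    flow a 1 q = Real.exp μ • q := by
  have : CompleteSpace V := FiniteDimensional.complete ℝ V
  rw [flow, one_smul]
  exact exp_apply_of_eigenvector h

lemma hasDerivAt_trFun_flow {f f' : ℝ → ℝ} (a y : V) {s : ℝ}
    (hf : HasFDerivAt (trFun f) (innerSL ℝ (funCalc f' (flow a s y))) (flow a s y)) :
    HasDerivAt (fun s => trFun f (flow a s y))
      (inner ℝ a (funCalc (fun t => f' t * t) (flow a s y))) s := by
  have h := hf.comp_hasDerivAt s (hasDerivAt_flow a y s)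
  have hmul := funCalc_mul f' (fun t => t) (flow a s y)
  rw [funCalc_id] at hmul
  rwa [innerSL_apply_apply, real_inner_comm, inner_mul_assoc, mul_comm, ← hmul] at h

end Flow

section Inertia

lemma hasFDerivAt_trFun_smoothSign (n : ℝ) (x : V) :
    HasFDerivAt (trFun (smoothSign n))
      (innerSL ℝ (funCalc (fun t => (Real.log n)⁻¹ * ((√(1 + (n * t) ^ 2))⁻¹ * n)) x)) x := by
  have hlip : LipschitzWith (‖(Real.log n)⁻¹ * n‖₊ * (1 * ‖n‖₊))
      fun t => (Real.log n)⁻¹ * ((√(1 + (n * t) ^ 2))⁻¹ * n) := by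
    have hcomp : (fun t : ℝ => (Real.log n)⁻¹ * ((√(1 + (n * t) ^ 2))⁻¹ * n)) =
        fun t => ((Real.log n)⁻¹ * n) • (√(1 + (n • t) ^ 2))⁻¹ := by
      ext t
      simp only [smul_eq_mul]
      ring
    rw [hcomp]
    exact (lipschitzWith_smul _).comp (lipschitzWith_inv_sqrt.comp (lipschitzWith_smul n))
  exact hasFDerivAt_trFun convex_univ (fun t _ => hasDerivAt_smoothSign n t)
    (lipschitzOnWith_univ.mpr hlip) (Eventually.of_forall fun _ => subset_univ _)

lemma abs_trFun_smoothSign_flow_sub_le {n : ℝ} (hn : 1 < n) (a y : V) (s : ℝ) :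
    |trFun (smoothSign n) (flow a s y) - trFun (smoothSign n) y| ≤
      ‖a‖ * ((Real.log n)⁻¹ * ‖(1 : V)‖) * |s| := by
  have hlog : 0 < Real.log n := Real.log_pos hn
  have h := convex_univ.norm_image_sub_le_of_norm_hasDerivWithin_le (x := 0) (y := s)
    (fun s _ => (hasDerivAt_trFun_flow a y
      (hasFDerivAt_trFun_smoothSign n (flow a s y))).hasDerivWithinAt)
    (C := ‖a‖ * ((Real.log n)⁻¹ * ‖(1 : V)‖)) (fun s _ => ?_) (mem_univ _) (mem_univ _)
  · simpa [flow_zero] using h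
  · refine (norm_inner_le_norm _ _).trans (mul_le_mul_of_nonneg_left
      (norm_funCalc_le (by positivity) _ fun t _ => ?_) (norm_nonneg a))
    have hle : |n * t| ≤ √(1 + (n * t) ^ 2) := Real.abs_le_sqrt (by linarith)
    calc |(Real.log n)⁻¹ * ((√(1 + (n * t) ^ 2))⁻¹ * n) * t|
        = (Real.log n)⁻¹ * (|n * t| / √(1 + (n * t) ^ 2)) := by
          rw [mul_assoc, abs_mul, abs_of_pos (inv_pos.mpr hlog), mul_assoc, abs_mul, abs_inv,
            abs_of_nonneg (Real.sqrt_nonneg _), inv_mul_eq_div (√_)]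
      _ ≤ (Real.log n)⁻¹ := mul_le_of_le_one_right (by positivity)
          (div_le_one_of_le₀ hle (by positivity))

/-- Sylvester's law of inertia. -/
theorem trFun_sign_flow (a y : V) (s : ℝ) : trFun Real.sign (flow a s y) = trFun Real.sign y := by
  have hdiff : Tendsto (fun n => trFun (smoothSign n) (flow a s y) - trFun (smoothSign n) y) atTop
      (𝓝 (trFun Real.sign (flow a s y) - trFun Real.sign y)) :=
    (tendsto_trFun fun t _ => tendsto_smoothSign t).sub
      (tendsto_trFun fun t _ => tendsto_smoothSign t)
  have hbound : Tendsto (fun n => ‖a‖ * ((Real.log n)⁻¹ * ‖(1 : V)‖) * |s|) atTop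
      (𝓝 (‖a‖ * (0 * ‖(1 : V)‖) * |s|)) :=
    ((Real.tendsto_log_atTop.inv_tendsto_atTop.mul_const _).const_mul _).mul_const _
  rw [zero_mul, mul_zero, zero_mul] at hbound
  refine sub_eq_zero.mp (tendsto_nhds_unique hdiff (squeeze_zero_norm' ?_ hbound))
  exact (eventually_gt_atTop 1).mono fun n hn => abs_trFun_smoothSign_flow_sub_le hn a y s

/-- The indicator function of the negative half-line, with value `1 / 2` at `0`. -/
noncomputable def negStep (t : ℝ) : ℝ := 2⁻¹ * (1 - Real.sign t)

lemma negStep_of_neg {t : ℝ} (h : t < 0) : negStep t = 1 := by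
  rw [negStep, Real.sign_of_neg h]
  norm_num

lemma negStep_of_pos {t : ℝ} (h : 0 < t) : negStep t = 0 := by
  rw [negStep, Real.sign_of_pos h, sub_self, mul_zero]

lemma negStep_eq_zero_iff {t : ℝ} : negStep t = 0 ↔ 0 < t := by
  refine ⟨fun h => ?_, negStep_of_pos⟩
  have hsign : Real.sign t = 1 := by
    rw [negStep] at h
    linarith
  by_contra! ht
  rcases ht.eq_or_lt with rfl | ht
  · exact zero_ne_one (Real.sign_zero ▸ hsign)
  · rw [Real.sign_of_neg ht] at hsign
    norm_num at hsign

lemma negStep_nonneg (t : ℝ) : 0 ≤ negStep t := by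
  rw [negStep]
  rcases Real.sign_apply_eq t with h | h | h <;> rw [h] <;> norm_num

lemma trFun_negStep (x : V) : trFun negStep x = 2⁻¹ * (tr (1 : V) - trFun Real.sign x) := by
  unfold negStep
  rw [trFun_const_mul, trFun_sub, trFun_const, one_mul]

lemma trFun_negStep_flow (a y : V) (s : ℝ) : trFun negStep (flow a s y) = trFun negStep y := by
  rw [trFun_negStep, trFun_sign_flow, trFun_negStep]

lemma posDef_iff_trFun_negStep_eq_zero {x : V} : PosDef x ↔ trFun negStep x = 0 := by
  rw [posDef_iff, trFun_eq_sum, Finset.sum_eq_zero_iff_of_nonneg fun t _ =>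
    mul_nonneg (negStep_nonneg t) (tr_nonneg_of_idempotent (spectral_mul_self x t))]
  refine forall₂_congr fun t ht => ?_
  rw [mul_eq_zero, or_iff_left (tr_spectral_pos ht).ne', negStep_eq_zero_iff]

lemma posDef_flow {y : V} (hy : PosDef y) (a : V) (s : ℝ) : PosDef (flow a s y) := by
  rwa [posDef_iff_trFun_negStep_eq_zero, trFun_negStep_flow, ← posDef_iff_trFun_negStep_eq_zero]

lemma PosDef.hasFDerivAt_trFun_log {x : V} (hx : PosDef x) :
    HasFDerivAt (trFun Real.log) (innerSL ℝ (funCalc (fun t => t⁻¹) x)) x := by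
  obtain ⟨δ, hδ, hx⟩ := hx
  exact hasFDerivAt_trFun (convex_Ici (δ / 2))
    (fun t ht => Real.hasDerivAt_log ((half_pos hδ).trans_le ht).ne')
    (lipschitzOnWith_inv (half_pos hδ))
    ((hx.eventually (half_lt_self hδ)).mono fun y hy t ht => atLeast_iff.mp hy t ht)

lemma trFun_log_flow {y : V} (hy : PosDef y) (a : V) (s : ℝ) :
    trFun Real.log (flow a s y) = trFun Real.log y + s * tr a := by
  have hderiv (s : ℝ) :
      HasDerivAt (fun s => trFun Real.log (flow a s y) - s * tr a) 0 s := by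
    have hlog := hasDerivAt_trFun_flow a y (posDef_flow hy a s).hasFDerivAt_trFun_log
    have hone : funCalc (fun t => t⁻¹ * t) (flow a s y) = 1 := by
      rw [funCalc_congr fun t ht => inv_mul_cancel₀ (posDef_iff.mp (posDef_flow hy a s) t ht).ne',
        funCalc_const, one_smul]
    rw [hone, ← tr] at hlog
    simpa using hlog.fun_sub ((hasDerivAt_id s).mul_const (tr a))
  have hconst := is_const_of_deriv_eq_zero (fun s => (hderiv s).differentiableAt)
    (fun s => (hderiv s).deriv) s 0
  rw [flow_zero, zero_mul, sub_zero] at hconst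
  exact eq_add_of_sub_eq hconst

lemma flow_neg_log_self {B : V} (hB : PosDef B) : flow (-log B) 1 B = 1 := by
  have hflow (t : ℝ) (ht : t ∈ (spectral B).support) :
      flow (-log B) 1 (t • spectral B t) = spectral B t := by
    have ht0 : 0 < t := posDef_iff.mp hB t ht
    have heigen : -log B * spectral B t = (-Real.log t) • spectral B t := by
      rw [neg_mul, log, funCalc_mul_spectral, neg_smul]
    rw [map_smul, flow_one_of_eigenvector heigen, Real.exp_neg, Real.exp_log ht0, smul_smul,
      mul_inv_cancel₀ ht0.ne', one_smul]
  calc flow (-log B) 1 B = ∑ t ∈ (spectral B).support, flow (-log B) 1 (t • spectral B t) := by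
        rw [← map_sum, ← funCalc_eq_sum (fun t => t), funCalc_id]
    _ = 1 := by rw [Finset.sum_congr rfl hflow, sum_spectral]

end Inertia

section ScalarKernels

/-- Minus the derivative of `log (t + 1) - log t`, the scalar case `logGap t 1` of the gap below. -/
noncomputable def invGap (t : ℝ) : ℝ := t⁻¹ - (t + 1)⁻¹

/-- Minus the derivative of `invGap`, the weight in the integral formula for `logGap`. -/
noncomputable def invGapDensity (t : ℝ) : ℝ := (t ^ 2)⁻¹ - ((t + 1) ^ 2)⁻¹

lemma hasDerivAt_invGap {t : ℝ} (ht : 0 < t) : HasDerivAt invGap (-invGapDensity t) t := by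
  have h := (hasDerivAt_inv ht.ne').sub ((hasDerivAt_inv (by positivity)).comp_add_const t 1)
  rwa [← neg_sub', ← invGapDensity] at h

lemma invGapDensity_nonneg {t : ℝ} (ht : 0 < t) : 0 ≤ invGapDensity t :=
  sub_nonneg.mpr (inv_anti₀ (by positivity) (by gcongr; linarith))

lemma invGap_nonneg {t : ℝ} (ht : 0 < t) : 0 ≤ invGap t :=
  sub_nonneg.mpr (inv_anti₀ ht (by linarith))

lemma tendsto_invGap : Tendsto invGap atTop (𝓝 0) := by
  have h := tendsto_inv_atTop_zero (𝕜 := ℝ)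
  rw [← sub_zero (0 : ℝ)]
  exact h.sub (h.comp (tendsto_atTop_add_const_right atTop 1 tendsto_id))

lemma measurable_invGapDensity : Measurable invGapDensity := by
  unfold invGapDensity
  fun_prop

lemma measurable_negStep : Measurable negStep := by
  unfold negStep Real.sign
  exact ((Measurable.ite measurableSet_Iio measurable_const
    (Measurable.ite measurableSet_Ioi measurable_const measurable_const)).const_sub 1).const_mul _

lemma setLIntegral_Ioi_of_hasDerivAt_neg {g k : ℝ → ℝ} {a : ℝ}
    (hderiv : ∀ x ∈ Ici a, HasDerivAt g (-k x) x) (hk : ∀ x ∈ Ioi a, 0 ≤ k x)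
    (hg : Tendsto g atTop (𝓝 0)) :
    0 ≤ g a ∧ ∫⁻ x in Ioi a, ENNReal.ofReal (k x) = ENNReal.ofReal (g a) := by
  have hneg : ∀ x ∈ Ioi a, -k x ≤ 0 := fun x hx => neg_nonpos.mpr (hk x hx)
  have hint : IntegrableOn k (Ioi a) := by
    simpa using (integrableOn_Ioi_deriv_of_nonpos' hderiv hneg hg).neg
  have heq : ∫ x in Ioi a, k x = g a := by
    have h := integral_Ioi_of_hasDerivAt_of_nonpos' hderiv hneg hg
    rwa [integral_neg, zero_sub, neg_inj] at h
  have hk' : 0 ≤ᵐ[volume.restrict (Ioi a)] k :=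
    (ae_restrict_iff' measurableSet_Ioi).mpr (Eventually.of_forall hk)
  rw [← heq]
  exact ⟨setIntegral_nonneg measurableSet_Ioi hk,
    (ofReal_integral_eq_lintegral_ofReal hint hk').symm⟩

lemma lintegral_invGapDensity_mul_negStep {t : ℝ} (ht : 0 < t) :
    ∫⁻ c in Ioi 0, ENNReal.ofReal (invGapDensity c * negStep (t - c)) =
      ENNReal.ofReal (invGap t) := by
  have hind : ∀ᵐ c ∂(volume.restrict (Ioi (0 : ℝ))),
      ENNReal.ofReal (invGapDensity c * negStep (t - c)) =
        (Ioi t).indicator (fun c => ENNReal.ofReal (invGapDensity c)) c := by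
    refine ae_restrict_of_ae ?_
    filter_upwards [Measure.ae_ne volume t] with c hc
    rcases lt_or_gt_of_ne hc with h | h
    · rw [negStep_of_pos (sub_pos.mpr h), mul_zero, ENNReal.ofReal_zero,
        indicator_of_notMem (notMem_Ioi.mpr h.le)]
    · rw [negStep_of_neg (sub_neg.mpr h), mul_one, indicator_of_mem (mem_Ioi.mpr h)]
  rw [lintegral_congr_ae hind, lintegral_indicator measurableSet_Ioi,
    Measure.restrict_restrict measurableSet_Ioi, inter_eq_left.mpr (Ioi_subset_Ioi ht.le)]
  exact (setLIntegral_Ioi_of_hasDerivAt_neg (fun c hc => hasDerivAt_invGap (ht.trans_le hc))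
    (fun c hc => invGapDensity_nonneg (ht.trans hc)) tendsto_invGap).2

lemma lintegral_negStep_add (t : ℝ) :
    ∫⁻ r in Ioi 0, ENNReal.ofReal (negStep (t + r)) = ENNReal.ofReal (max (-t) 0) := by
  have hind : ∀ᵐ r ∂(volume.restrict (Ioi (0 : ℝ))),
      ENNReal.ofReal (negStep (t + r)) = (Iio (-t)).indicator 1 r := by
    refine ae_restrict_of_ae ?_
    filter_upwards [Measure.ae_ne volume (-t)] with r hr
    rcases lt_or_gt_of_ne hr with h | h
    · rw [negStep_of_neg (by linarith), ENNReal.ofReal_one, indicator_of_mem (mem_Iio.mpr h),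
        Pi.one_apply]
    · rw [negStep_of_pos (by linarith), ENNReal.ofReal_zero,
        indicator_of_notMem (notMem_Iio.mpr h.le)]
  rw [lintegral_congr_ae hind, lintegral_indicator_one measurableSet_Iio,
    Measure.restrict_apply measurableSet_Iio, inter_comm, Ioi_inter_Iio, Real.volume_Ioo, sub_zero,
    ENNReal.ofReal_max, ENNReal.ofReal_zero, max_eq_left zero_le]

end ScalarKernels

section TraceIntegrals

lemma ofReal_trFun {f : ℝ → ℝ} {x : V} (h : ∀ t ∈ (spectral x).support, 0 ≤ f t) :
    ENNReal.ofReal (trFun f x) =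
      ∑ t ∈ (spectral x).support, ENNReal.ofReal (f t) * ENNReal.ofReal (tr (spectral x t)) := by
  rw [trFun_eq_sum, ENNReal.ofReal_sum_of_nonneg
    fun t ht => mul_nonneg (h t ht) (tr_spectral_pos ht).le]
  exact Finset.sum_congr rfl fun t ht => ENNReal.ofReal_mul (h t ht)

lemma lintegral_ofReal_trFun {α : Type*} [MeasurableSpace α] {μ : Measure α} {F : α → ℝ → ℝ}
    {f : ℝ → ℝ} {x : V} (hF : ∀ᵐ a ∂μ, ∀ t ∈ (spectral x).support, 0 ≤ F a t)
    (hmeas : ∀ t, Measurable fun a => F a t) (hf : ∀ t ∈ (spectral x).support, 0 ≤ f t)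
    (h : ∀ t ∈ (spectral x).support, ∫⁻ a, ENNReal.ofReal (F a t) ∂μ = ENNReal.ofReal (f t)) :
    ∫⁻ a, ENNReal.ofReal (trFun (F a) x) ∂μ = ENNReal.ofReal (trFun f x) := by
  rw [ofReal_trFun hf, lintegral_congr_ae (hF.mono fun a ha => ofReal_trFun ha),
    lintegral_finsetSum _ fun t _ => (hmeas t).ennreal_ofReal.mul_const _]
  refine Finset.sum_congr rfl fun t ht => ?_
  rw [lintegral_mul_const _ (hmeas t).ennreal_ofReal, h t ht]

lemma lintegral_trFun_negStep_add (y : V) :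
    ∫⁻ r in Ioi (0 : ℝ), ENNReal.ofReal (trFun negStep (y + r • 1)) = ENNReal.ofReal (trNeg y) := by
  simp_rw [trFun_add_smul_one]
  exact lintegral_ofReal_trFun (Eventually.of_forall fun _ _ _ => negStep_nonneg _)
    (fun t => measurable_negStep.comp (measurable_id.const_add t))
    (fun _ _ => le_max_right _ _) (fun t _ => lintegral_negStep_add t)

lemma lintegral_invGapDensity_mul_trFun_negStep {x : V} (hx : PosDef x) :
    ∫⁻ c in Ioi 0, ENNReal.ofReal (invGapDensity c * trFun negStep (x - c • 1)) =
      ENNReal.ofReal (trFun invGap x) := by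
  have hpos := posDef_iff.mp hx
  simp_rw [sub_eq_add_neg x, ← neg_smul, trFun_add_smul_one, ← trFun_const_mul, ← sub_eq_add_neg]
  refine lintegral_ofReal_trFun ?_
    (fun t => measurable_invGapDensity.mul (measurable_negStep.comp (measurable_id.const_sub t)))
    (fun t ht => invGap_nonneg (hpos t ht))
    (fun t ht => lintegral_invGapDensity_mul_negStep (hpos t ht))
  filter_upwards [ae_restrict_mem measurableSet_Ioi] with c hc t _
  exact mul_nonneg (invGapDensity_nonneg hc) (negStep_nonneg _)

lemma measurable_trFun_negStep [MeasurableSpace V] [BorelSpace V] :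
    Measurable (trFun negStep : V → ℝ) := by
  have hsign : Measurable (trFun Real.sign : V → ℝ) :=
    measurable_of_tendsto_metrizable (f := fun n : ℕ => trFun (smoothSign n))
      (fun n => (continuous_iff_continuousAt.mpr fun x =>
        (hasFDerivAt_trFun_smoothSign n x).continuousAt).measurable)
      (tendsto_pi_nhds.mpr fun x => tendsto_trFun fun t _ =>
        (tendsto_smoothSign t).comp tendsto_natCast_atTop_atTop)
  simp_rw [funext trFun_negStep]
  exact (hsign.const_sub _).const_mul _

end TraceIntegrals

section LogGap

lemma PosDef.eventually {x : V} (hx : PosDef x) : ∀ᶠ y in 𝓝 x, PosDef y := by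
  obtain ⟨δ, hδ, hx⟩ := hx
  exact (hx.eventually (half_lt_self hδ)).mono fun y hy => ⟨δ / 2, half_pos hδ, hy⟩

/-- Differentiate the invariance of `tr log` under the flow, up to a constant. -/
lemma inner_inv_flow {x : V} (hx : PosDef x) (a v : V) (s : ℝ) :
    inner ℝ (funCalc (fun t => t⁻¹) (flow a s x)) (flow a s v) =
      inner ℝ (funCalc (fun t => t⁻¹) x) v := by
  have hflow := (posDef_flow hx a s).hasFDerivAt_trFun_log.comp x (flow a s).hasFDerivAt
  have hconst := hx.hasFDerivAt_trFun_log.add_const (s * tr a)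
  have heq := hflow.unique (hconst.congr_of_eventuallyEq
    (hx.eventually.mono fun y hy => trFun_log_flow hy a s))
  exact DFunLike.congr_fun heq v

lemma inner_inv_eq_trFun {x B : V} (hx : PosDef x) (hB : PosDef B) :
    inner ℝ (funCalc (fun t => t⁻¹) x) B = trFun (fun t => t⁻¹) (flow (-log B) 1 x) := by
  rw [← inner_inv_flow hx (-log B) B 1, flow_neg_log_self hB, trFun, tr]

/-- The increment of the logarithm from `A` to `A + B`, paired with `B`. -/
noncomputable def logGap (A B : V) : ℝ := inner ℝ (log (A + B) - log A) B

lemma log_add_smul_one (x : V) (r : ℝ) :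
    log (x + r • 1) = funCalc (fun t => Real.log (t + r)) x := by
  rw [log, add_smul_one_eq_funCalc, funCalc_funCalc]

lemma hasDerivAt_log_add_smul_one {x : V} (hx : PosDef x) {r : ℝ} (hr : 0 ≤ r) :
    HasDerivAt (fun r : ℝ => log (x + r • 1)) (funCalc (fun t => t⁻¹) (x + r • 1)) r := by
  simp_rw [log_add_smul_one]
  rw [add_smul_one_eq_funCalc, funCalc_funCalc]
  simp only [funCalc_eq_sum]
  refine HasDerivAt.fun_sum fun t ht => HasDerivAt.smul_const ?_ _
  have hpos : 0 < t + r := add_pos_of_pos_of_nonneg (posDef_iff.mp hx t ht) hr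
  exact (Real.hasDerivAt_log hpos.ne').comp_const_add t r

lemma hasDerivAt_logGap_add_smul_one {A B : V} (hA : PosDef A) (hB : PosDef B) {r : ℝ}
    (hr : 0 ≤ r) :
    HasDerivAt (fun r : ℝ => logGap (A + r • 1) B)
      (-trFun invGap (flow (-log B) 1 (A + r • 1))) r := by
  have h := ((hasDerivAt_log_add_smul_one (hA.add hB) hr).sub
    (hasDerivAt_log_add_smul_one hA hr)).inner ℝ (hasDerivAt_const r B)
  have hAr : PosDef (A + r • 1) :=
    add_comm A (r • 1) ▸ ((atLeast_smul_one r).mono hr).posDef_add hA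
  have hvalue : inner ℝ (funCalc (fun t => t⁻¹) (A + B + r • 1) -
      funCalc (fun t => t⁻¹) (A + r • 1)) B = -trFun invGap (flow (-log B) 1 (A + r • 1)) := by
    rw [add_right_comm, inner_sub_left, inner_inv_eq_trFun (hAr.add hB) hB,
      inner_inv_eq_trFun hAr hB, map_add, flow_neg_log_self hB]
    unfold invGap
    rw [trFun_sub, neg_sub, ← trFun_add_smul_one, one_smul]
  rw [inner_zero_right, zero_add, hvalue] at h
  simp only [logGap, add_right_comm A _ B]
  exact h

lemma tendsto_logGap_add_smul_one (A B : V) :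
    Tendsto (fun r : ℝ => logGap (A + r • 1) B) atTop (𝓝 0) := by
  have hlog (x : V) :
      Tendsto (fun r : ℝ => log (x + r • 1) - Real.log r • (1 : V)) atTop (𝓝 0) := by
    have h := tendsto_funCalc (x := x) fun t _ => Real.tendsto_log_comp_add_sub_log t
    rw [funCalc_const, zero_smul] at h
    refine h.congr fun r => ?_
    rw [funCalc_sub, funCalc_const, log_add_smul_one]
    simp only [add_comm]
  have h := ((hlog (A + B)).sub (hlog A)).inner (𝕜 := ℝ) (tendsto_const_nhds (x := B))
  rw [sub_zero, inner_zero_left] at h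
  refine h.congr fun r => ?_
  rw [sub_sub_sub_cancel_right, logGap, add_right_comm]

lemma logGap_nonneg_and_lintegral_invGap {A B : V} (hA : PosDef A) (hB : PosDef B) :
    0 ≤ logGap A B ∧ ∫⁻ r in Ioi (0 : ℝ), ENNReal.ofReal
      (trFun invGap (flow (-log B) 1 (A + r • 1))) = ENNReal.ofReal (logGap A B) := by
  have h := setLIntegral_Ioi_of_hasDerivAt_neg (a := 0)
    (fun r hr => hasDerivAt_logGap_add_smul_one hA hB hr)
    (fun r hr => trFun_nonneg fun t ht => invGap_nonneg (posDef_iff.mp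
      (posDef_flow (hA.add (posDef_smul_one hr)) (-log B) 1) t ht))
    (tendsto_logGap_add_smul_one A B)
  rwa [zero_smul, add_zero] at h

/-- Frenkel's integral formula. By inertia, `A + r • 1 - c • B` may be replaced by its image under
the congruence that maps `B` to `1`, which turns the inner integral into a trace function. -/
theorem lintegral_invGapDensity_mul_trNeg {A B : V} (hA : PosDef A) (hB : PosDef B) :
    ∫⁻ c in Ioi 0, ENNReal.ofReal (invGapDensity c * trNeg (A - c • B)) =
      ENNReal.ofReal (logGap A B) := by
  borelize V
  have hmeas : Measurable fun q : ℝ × ℝ => ENNReal.ofReal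
      (invGapDensity q.1 * trFun negStep (A - q.1 • B + q.2 • 1)) :=
    ((measurable_invGapDensity.comp measurable_fst).mul
      (measurable_trFun_negStep.comp (by fun_prop : Continuous fun q : ℝ × ℝ =>
        A - q.1 • B + q.2 • (1 : V)).measurable)).ennreal_ofReal
  have houter : ∀ c ∈ Ioi (0 : ℝ), ENNReal.ofReal (invGapDensity c * trNeg (A - c • B)) =
      ∫⁻ r in Ioi (0 : ℝ),
        ENNReal.ofReal (invGapDensity c * trFun negStep (A - c • B + r • 1)) := fun c hc => by
    simp_rw [ENNReal.ofReal_mul (invGapDensity_nonneg hc)]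
    rw [lintegral_const_mul' _ _ ENNReal.ofReal_ne_top, lintegral_trFun_negStep_add]
  have hinner : ∀ r ∈ Ioi (0 : ℝ), ∫⁻ c in Ioi (0 : ℝ),
      ENNReal.ofReal (invGapDensity c * trFun negStep (A - c • B + r • 1)) =
        ENNReal.ofReal (trFun invGap (flow (-log B) 1 (A + r • 1))) := fun r hr => by
    rw [← lintegral_invGapDensity_mul_trFun_negStep
      (posDef_flow (hA.add (posDef_smul_one hr)) (-log B) 1)]
    refine lintegral_congr fun c => ?_
    rw [← trFun_negStep_flow (-log B) _ 1, sub_add_eq_add_sub, map_sub, map_smul,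
      flow_neg_log_self hB]
  rw [setLIntegral_congr_fun measurableSet_Ioi houter, lintegral_lintegral_swap hmeas.aemeasurable,
    setLIntegral_congr_fun measurableSet_Ioi hinner, (logGap_nonneg_and_lintegral_invGap hA hB).2]

/-- The integral formula reduces this to the subadditivity of `trNeg`. -/
theorem logGap_add_le {A A' B B' : V} (hA : PosDef A) (hA' : PosDef A') (hB : PosDef B)
    (hB' : PosDef B') : logGap (A + A') (B + B') ≤ logGap A B + logGap A' B' := by
  have hG := (logGap_nonneg_and_lintegral_invGap hA hB).1
  have hG' := (logGap_nonneg_and_lintegral_invGap hA' hB').1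
  have hmeas : Measurable fun c : ℝ => ENNReal.ofReal (invGapDensity c * trNeg (A - c • B)) :=
    (measurable_invGapDensity.mul (continuous_trNeg.comp (by fun_prop :
      Continuous fun c : ℝ => A - c • B)).measurable).ennreal_ofReal
  rw [← ENNReal.ofReal_le_ofReal_iff (add_nonneg hG hG'), ENNReal.ofReal_add hG hG',
    ← lintegral_invGapDensity_mul_trNeg (hA.add hA') (hB.add hB'),
    ← lintegral_invGapDensity_mul_trNeg hA hB, ← lintegral_invGapDensity_mul_trNeg hA' hB',
    ← lintegral_add_left hmeas]
  refine setLIntegral_mono' measurableSet_Ioi fun c hc => ?_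
  have hk := invGapDensity_nonneg hc
  rw [← ENNReal.ofReal_add (mul_nonneg hk (trNeg_nonneg _)) (mul_nonneg hk (trNeg_nonneg _)),
    ← mul_add, smul_add, add_sub_add_comm]
  exact ENNReal.ofReal_le_ofReal (mul_le_mul_of_nonneg_left (trNeg_add_le _ _) hk)

end LogGap

section RelativeEntropy

lemma log_smul {x : V} (hx : PosDef x) {r : ℝ} (hr : 0 < r) :
    log (r • x) = Real.log r • 1 + log x := by
  rw [log, smul_eq_funCalc, funCalc_funCalc, log, ← funCalc_const _ x, ← funCalc_add]
  exact funCalc_congr fun t ht => Real.log_mul hr.ne' (posDef_iff.mp hx t ht).ne'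

lemma PosDef.continuousAt_log {x : V} (hx : PosDef x) : ContinuousAt log x := by
  obtain ⟨δ, hδ, hx⟩ := hx
  exact (lipschitzOnWith_funCalc (lipschitzOnWith_log (half_pos hδ))).continuousOn.continuousAt
    ((hx.eventually (half_lt_self hδ)).mono fun y hy t ht => atLeast_iff.mp hy t ht)

/-- The value `tr (ρ * log ρ - ρ * log σ)` of the relative entropy where it is finite. -/
noncomputable def finiteEntropy (ρ σ : V) : ℝ := inner ℝ ρ (log ρ) - inner ℝ ρ (log σ)

lemma tr_mul_log_sub (ρ σ : V) : tr (ρ * log ρ - ρ * log σ) = finiteEntropy ρ σ := by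
  rw [tr, inner_sub_left, ← tr, ← tr, tr_mul, tr_mul, finiteEntropy]

/-- Scaling `A` down turns the logarithmic gap `⟪log (A + B) - log A, B⟫` into the relative
entropy, up to a term that is linear in `B`. -/
lemma tendsto_logGap_smul {ρ σ : V} (hρ : PosDef ρ) (hσ : PosDef σ) :
    Tendsto (fun ε : ℝ => logGap (ε • σ) ρ + Real.log ε * tr ρ) (𝓝[>] 0)
      (𝓝 (finiteEntropy ρ σ)) := by
  have hbase : Tendsto (fun ε : ℝ => ε • σ + ρ) (𝓝[>] 0) (𝓝 ρ) :=
    (Continuous.tendsto' (by fun_prop) 0 ρ (by simp)).mono_left nhdsWithin_le_nhds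
  have h := ((hρ.continuousAt_log.tendsto.comp hbase).sub_const (log σ)).inner (𝕜 := ℝ)
    (tendsto_const_nhds (x := ρ))
  rw [inner_sub_left, real_inner_comm, real_inner_comm ρ (log σ)] at h
  refine h.congr' ?_
  filter_upwards [self_mem_nhdsWithin] with ε hε
  rw [logGap, log_smul hσ hε, ← sub_sub, sub_right_comm, inner_sub_left _ (_ • 1),
    real_inner_smul_left, real_inner_comm ρ 1, ← tr, sub_add_cancel]
  rfl

theorem finiteEntropy_add_le {ρ ρ' σ σ' : V} (hρ : PosDef ρ) (hρ' : PosDef ρ') (hσ : PosDef σ)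
    (hσ' : PosDef σ') :
    finiteEntropy (ρ + ρ') (σ + σ') ≤ finiteEntropy ρ σ + finiteEntropy ρ' σ' := by
  refine le_of_tendsto_of_tendsto (tendsto_logGap_smul (hρ.add hρ') (hσ.add hσ'))
    ((tendsto_logGap_smul hρ hσ).add (tendsto_logGap_smul hρ' hσ')) ?_
  filter_upwards [self_mem_nhdsWithin] with ε hε
  have h := logGap_add_le (hσ.smul hε) (hσ'.smul hε) hρ hρ'
  rw [smul_add, tr, inner_add_left, ← tr, ← tr]
  linarith

lemma finiteEntropy_smul {ρ σ : V} (hρ : PosDef ρ) (hσ : PosDef σ) {r : ℝ} (hr : 0 < r) :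
    finiteEntropy (r • ρ) (r • σ) = r * finiteEntropy ρ σ := by
  rw [finiteEntropy, finiteEntropy, ← inner_sub_right, ← inner_sub_right, log_smul hρ hr,
    log_smul hσ hr, add_sub_add_left_eq_sub, real_inner_smul_left]

lemma tendsto_inner_log_self_add_smul_one (ρ : V) :
    Tendsto (fun ε : ℝ => inner ℝ (ρ + ε • 1) (log (ρ + ε • 1))) (𝓝[>] 0)
      (𝓝 (inner ℝ ρ (log ρ))) := by
  have inner_log_self (x : V) : inner ℝ x (log x) = trFun (fun t => t * Real.log t) x := by
    rw [trFun_mul, funCalc_id, log]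
  simp only [inner_log_self, trFun_add_smul_one]
  refine tendsto_trFun fun t _ => ?_
  have h : Continuous fun ε : ℝ => (t + ε) * Real.log (t + ε) :=
    Real.continuous_mul_log.comp (continuous_const_add t)
  exact (h.tendsto' 0 _ (by rw [add_zero])).mono_left nhdsWithin_le_nhds

/-- The only singular term comes from the eigenvalue `0` of `σ`. -/
lemma tendsto_log_add_smul_one_sub (σ : V) :
    Tendsto (fun ε : ℝ => log (σ + ε • 1) - Real.log ε • spectral σ 0) (𝓝[>] 0)
      (𝓝 (log σ)) := by
  simp only [log_add_smul_one, spectral_apply_eq_funCalc σ 0, ← funCalc_const_mul, ← funCalc_sub]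
  refine tendsto_funCalc fun t _ => ?_
  obtain rfl | ht := eq_or_ne t 0
  · simp
  · have h : ContinuousAt (fun ε : ℝ => Real.log (t + ε)) 0 :=
      ContinuousAt.log (by fun_prop) (by simpa using ht)
    simpa [ht] using h.tendsto.mono_left nhdsWithin_le_nhds

lemma tendsto_finiteEntropy_add_smul_one (ρ σ : V) :
    Tendsto (fun ε : ℝ => finiteEntropy (ρ + ε • 1) (σ + ε • 1) +
      Real.log ε * inner ℝ ρ (spectral σ 0)) (𝓝[>] 0) (𝓝 (finiteEntropy ρ σ)) := by
  have hρ : Tendsto (fun ε : ℝ => ρ + ε • (1 : V)) (𝓝[>] 0) (𝓝 ρ) :=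
    (Continuous.tendsto' (by fun_prop) 0 ρ (by simp)).mono_left nhdsWithin_le_nhds
  have hε : Tendsto (fun ε : ℝ => ε * Real.log ε) (𝓝[>] 0) (𝓝 0) :=
    (Real.continuous_mul_log.tendsto' 0 0 (by simp)).mono_left nhdsWithin_le_nhds
  have h := ((tendsto_inner_log_self_add_smul_one ρ).sub
    (hρ.inner (𝕜 := ℝ) (tendsto_log_add_smul_one_sub σ))).sub
    (hε.mul_const (tr (spectral σ 0)))
  rw [zero_mul, sub_zero] at h
  refine h.congr fun ε => ?_
  rw [finiteEntropy, inner_sub_right, real_inner_smul_right, inner_add_left _ _ (spectral σ 0),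
    real_inner_smul_left, real_inner_comm _ (1 : V), ← tr]
  ring

theorem tendsto_relEntropy {ρ : V} (hρ : AtLeast 0 ρ) (σ : V) :
    Tendsto (fun ε : ℝ => (finiteEntropy (ρ + ε • 1) (σ + ε • 1) : EReal)) (𝓝[>] 0)
      (𝓝 (relEntropy ρ σ)) := by
  have h := tendsto_finiteEntropy_add_smul_one ρ σ
  rw [relEntropy, tr_mul, tr_mul_log_sub]
  split_ifs with h0
  · simp only [h0, mul_zero, add_zero] at h
    exact EReal.tendsto_coe.mpr h
  · have hweight : 0 < inner ℝ ρ (spectral σ 0) :=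
      lt_of_le_of_ne (by simpa using hρ _ (spectral_mul_self σ 0)) (Ne.symm h0)
    have hsingular := Real.tendsto_log_nhdsGT_zero.atBot_mul_const hweight
    refine EReal.tendsto_coe_nhds_top_iff.mpr
      ((h.add_atTop (tendsto_neg_atBot_atTop.comp hsingular)).congr fun ε => ?_)
    exact add_neg_cancel_right _ _

lemma tendsto_const_mul_nhdsGT_zero {r : ℝ} (hr : 0 < r) :
    Tendsto (fun ε : ℝ => r * ε) (𝓝[>] 0) (𝓝[>] 0) :=
  tendsto_nhdsWithin_iff.mpr
    ⟨((continuous_const_mul r).tendsto' 0 0 (mul_zero r)).mono_left nhdsWithin_le_nhds,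
      eventually_mem_nhdsWithin.mono fun _ hε => mul_pos hr hε⟩

lemma relEntropy_ne_bot (ρ σ : V) : relEntropy ρ σ ≠ ⊥ := by
  rw [relEntropy]
  split_ifs
  exacts [EReal.coe_ne_bot _, top_ne_bot]

lemma relEntropy_zero_left (σ : V) : relEntropy 0 σ = 0 := by
  rw [relEntropy, tr_mul, inner_zero_left, if_pos rfl, tr_mul_log_sub, finiteEntropy,
    inner_zero_left, inner_zero_left, sub_zero, EReal.coe_zero]

theorem relEntropy_add_le {ρ ρ' σ σ' : V} (hρ : AtLeast 0 ρ) (hρ' : AtLeast 0 ρ')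
    (hσ : AtLeast 0 σ) (hσ' : AtLeast 0 σ') :
    relEntropy (ρ + ρ') (σ + σ') ≤ relEntropy ρ σ + relEntropy ρ' σ' := by
  have hadd : AtLeast 0 (ρ + ρ') := by simpa using hρ.add hρ'
  have hsum := (EReal.continuousAt_add (.inr (relEntropy_ne_bot ρ' σ'))
    (.inl (relEntropy_ne_bot ρ σ))).tendsto.comp
      ((tendsto_relEntropy hρ σ).prodMk_nhds (tendsto_relEntropy hρ' σ'))
  refine le_of_tendsto_of_tendsto ((tendsto_relEntropy hadd _).comp
    (tendsto_const_mul_nhdsGT_zero two_pos)) hsum ?_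
  filter_upwards [self_mem_nhdsWithin] with ε hε
  have hone := posDef_smul_one (V := V) hε
  have h := finiteEntropy_add_le (hρ.posDef_add hone) (hρ'.posDef_add hone) (hσ.posDef_add hone)
    (hσ'.posDef_add hone)
  rw [add_add_add_comm, add_add_add_comm σ, ← add_smul, ← two_mul] at h
  simp only [Function.comp_apply]
  exact_mod_cast h

lemma relEntropy_smul {ρ σ : V} (hρ : AtLeast 0 ρ) (hσ : AtLeast 0 σ) {r : ℝ} (hr : 0 ≤ r) :
    relEntropy (r • ρ) (r • σ) = r * relEntropy ρ σ := by
  obtain rfl | hr := hr.eq_or_lt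
  · rw [zero_smul, relEntropy_zero_left, EReal.coe_zero, zero_mul]
  have hsmul : AtLeast 0 (r • ρ) := by simpa using hρ.smul hr.le
  have hlim := EReal.Tendsto.const_mul (tendsto_relEntropy hρ σ)
    (.inl (EReal.coe_ne_bot r)) (.inl (EReal.coe_ne_top r))
  refine tendsto_nhds_unique ((tendsto_relEntropy hsmul _).comp
    (tendsto_const_mul_nhdsGT_zero hr)) (hlim.congr' ?_)
  filter_upwards [self_mem_nhdsWithin] with ε hε
  have hone := posDef_smul_one (V := V) hε
  have h := finiteEntropy_smul (hρ.posDef_add hone) (hσ.posDef_add hone) hr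
  rw [smul_add, smul_add, smul_smul] at h
  simp only [Function.comp_apply]
  exact_mod_cast h.symm

theorem relEntropy_sum_le {ι : Type*} {s : Finset ι} {ρ σ : ι → V}
    (h : ∀ i ∈ s, AtLeast 0 (ρ i) ∧ AtLeast 0 (σ i)) :
    relEntropy (∑ i ∈ s, ρ i) (∑ i ∈ s, σ i) ≤ ∑ i ∈ s, relEntropy (ρ i) (σ i) := by
  have hsub := Finset.le_sum_of_subadditive_on_pred (fun x : V × V => relEntropy x.1 x.2)
    (fun x => AtLeast 0 x.1 ∧ AtLeast 0 x.2) (relEntropy_zero_left 0).le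
    (fun x y hx hy => relEntropy_add_le hx.1 hy.1 hx.2 hy.2)
    (fun x y hx hy => ⟨by simpa using hx.1.add hy.1, by simpa using hx.2.add hy.2⟩)
    (fun i => (ρ i, σ i)) h
  rwa [Prod.fst_sum, Prod.snd_sum] at hsub

end RelativeEntropy

end EuclideanJordanAlgebra

open EuclideanJordanAlgebra in
theorem theorem4p4_general {V : Type*} [EuclideanJordanAlgebra V] {ι : Type*} {s : Finset ι}
    {ρ σ : ι → V} (hρ : ∀ i ∈ s, ρ i ∈ positiveCone V) (hσ : ∀ i ∈ s, σ i ∈ positiveCone V)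
    {p : ι → ℝ} (hp : ∀ i ∈ s, 0 ≤ p i) :
    relEntropy (∑ i ∈ s, p i • ρ i) (∑ i ∈ s, p i • σ i) ≤
      ∑ i ∈ s, ((p i : ℝ) : EReal) * relEntropy (ρ i) (σ i) := by
  have hsmul {x : V} {r : ℝ} (hr : 0 ≤ r) (hx : x ∈ positiveCone V) : AtLeast 0 (r • x) := by
    simpa using (atLeast_zero_of_mem_positiveCone hx).smul hr
  refine (relEntropy_sum_le fun i hi =>
    ⟨hsmul (hp i hi) (hρ i hi), hsmul (hp i hi) (hσ i hi)⟩).trans_eq ?_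
  exact Finset.sum_congr rfl fun i hi =>
    relEntropy_smul (atLeast_zero_of_mem_positiveCone (hρ i hi))
      (atLeast_zero_of_mem_positiveCone (hσ i hi)) (hp i hi)

theorem theorem4p4 {V : Type*} [EuclideanJordanAlgebra V] (k : ℕ) (ρ σ : Fin k → V)
    (hρ : ∀ i, EuclideanJordanAlgebra.IsState (ρ i))
    (hσ : ∀ i, EuclideanJordanAlgebra.IsState (σ i))
    (p : Fin k → ℝ) (hp : ∀ i, 0 ≤ p i) (hp1 : ∑ i, p i = 1) :
    EuclideanJordanAlgebra.relEntropy (∑ i, p i • ρ i) (∑ i, p i • σ i) ≤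
      ∑ i, ((p i : ℝ) : EReal) * EuclideanJordanAlgebra.relEntropy (ρ i) (σ i) :=
  theorem4p4_general (fun i _ => (hρ i).1) (fun i _ => (hσ i).1) fun i _ => hp i
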